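/- Let $\lambda^{-1}>1$ be a Pisot–Vijayaraghavan number, i.e. a real algebraic integer greater than $1$ all of whose other Galois conjugates have absolute value less than $1$. Let $m\ge 1$, let $p_1,\dots,p_m\ge 1$ be integers and let $b_1,\dots,b_m\in\mathbb{Q}$ be not all zero. Put $S_i(x)=\lambda^{p_i}x+b_i$ for $1\le i\le m$. The family $\{S_i\}$ satisfies the open set condition (OSC) if there is a non-empty open set $U\subset\mathbb{R}$ with $\bigcup_i S_i(U)\subset U$ and $S_i(U)\cap S_j(U)=\varnothing$ for all $i\ne j$. Equip $\mathbb{Z}\times\mathbb{R}$ with the group law $(n,x)(n',x')=(n+n',\lambda^{n}x'+x)$, so that $(n,x)^{-1}=(-n,-\lambda^{-n}x)$. For a finite non-empty word $\sigma=i_1\cdots i_k$ over $\{1,\dots,m\}$ put $(p_\sigma,b_\sigma)=(p_{i_1},b_{i_1})\cdots(p_{i_k},b_{i_k})$. Let $T=\max_i p_i$, $B=\{0,b_1,\dots,b_m\}$, $$\mathcal{A}=\Big\{x\in\mathbb{R}:\ |x|<\frac{2\max_i|b_i|}{(1-\lambda)^2},\ \ \lambda^{-T+2}x=R(\lambda^{-1})\text{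 for some polynomial }R\text{ with all coefficients in }B-B\Big\},$$ and $\Theta=\{n\in\mathbb{Z}:0\le n\le T-1\}\times\mathcal{A}$. Let $G^*$ be the directed graph with vertex set $\Theta$ in which there is an edge from $(q,c)$ to $(q',c')$ if and only if there are words $\alpha,\beta$ with $1\le p_\alpha\le 2T-1$ and $1\le p_\beta\le 2T-1$ such that $$(q',c')=(p_\beta,b_\beta)^{-1}(q,c)(p_\alpha,b_\alpha)$$ and $q,\ q-p_\beta,\ q'$ have alternating signs, i.e. $q(q-p_\beta)\le 0$ and $(q-p_\beta)q'\le 0$. Let $$\Psi=\Big\{(p_i,b_i)^{-1}(p_j,b_j):\ i\ne j,\ p_j\ge p_i,\ \lambda^{-p_i}|b_j-b_i|<\frac{2\max_k|b_k|}{(1-\lambda)^2}\Big\}\subset\Theta .$$ Then the OSC fails for $\{S_i\}_{i=1}^m$ if and only if there is a directed path in $G^*$ starting at a point of $\Psi$ and ending at $(0,0)$. -/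

import Mathlib

noncomputable section

namespace OSCGraph

/-- A Pisot-Vijayaraghavan number: a real algebraic integer greater than `1` all of whose other
Galois conjugates (complex roots of its minimal polynomial) have absolute value less than `1`. -/
def IsPV (θ : ℝ) : Prop :=
  1 < θ ∧ IsIntegral ℤ θ ∧
    ∀ z : ℂ, Polynomial.aeval z (minpoly ℚ θ) = 0 → z ≠ (θ : ℂ) → ‖z‖ < 1

/-- The open set condition for a family of self-maps of the real line. -/
def OpenSetCondition {ι : Type*} (f : ι → ℝ → ℝ) : Prop :=
  ∃ U : Set ℝ, IsOpen U ∧ U.Nonempty ∧ (⋃ i, f i '' U) ⊆ U ∧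
    ∀ i j, i ≠ j → f i '' U ∩ f j '' U = ∅

/-- The similitude `h_(n,x) : t ↦ lam ^ n * t + x` attached to `(n, x) ∈ ℤ × ℝ`. -/
def simil (lam : ℝ) (g : ℤ × ℝ) : ℝ → ℝ := fun t => lam ^ g.1 * t + g.2

/-- The product on `ℤ × ℝ` corresponding to composition of similitudes. -/
def gmul (lam : ℝ) (g h : ℤ × ℝ) : ℤ × ℝ := (g.1 + h.1, lam ^ g.1 * h.2 + g.2)

/-- The inverse on `ℤ × ℝ` corresponding to the inverse similitude. -/
def ginv (lam : ℝ) (g : ℤ × ℝ) : ℤ × ℝ := (-g.1, -(lam ^ (-g.1) * g.2))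

theorem simil_gmul {lam : ℝ} (hlam : lam ≠ 0) (g h : ℤ × ℝ) :
    simil lam (gmul lam g h) = simil lam g ∘ simil lam h := by
  funext t
  simp only [simil, gmul, Function.comp, zpow_add₀ hlam]
  ring

theorem gmul_ginv {lam : ℝ} (hlam : lam ≠ 0) (g : ℤ × ℝ) :
    gmul lam g (ginv lam g) = (0, 0) ∧ gmul lam (ginv lam g) g = (0, 0) := by
  have h : lam ^ g.1 ≠ 0 := zpow_ne_zero _ hlam
  constructor <;> ext <;> simp [gmul, ginv, zpow_neg, h]

section IFS

variable {m : ℕ} (lam : ℝ) (p : Fin m → ℕ) (b : Fin m → ℚ)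

/-- The element `(p_i, b_i)` of `ℤ × ℝ`. -/
def letter (i : Fin m) : ℤ × ℝ := ((p i : ℤ), (b i : ℝ))

/-- The iterated function system `S_i(t) = lam ^ (p_i) * t + b_i`. -/
def ifs (i : Fin m) : ℝ → ℝ := fun t => lam ^ p i * t + (b i : ℝ)

/-- `(p_σ, b_σ)`: the product of the letters of the word `σ`. -/
def wordElt (σ : List (Fin m)) : ℤ × ℝ :=
  σ.foldr (fun i g => gmul lam (letter p b i) g) (0, 0)

/-- `T = max_i p_i`. -/
def maxExp : ℕ := Finset.univ.sup p

/-- `max_i |b_i|`. -/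
def maxAbs : ℝ := ⨆ i, |(b i : ℝ)|

/-- The bound `2 max_i |b_i| / (1 - lam) ^ 2`. -/
def dStar : ℝ := 2 * maxAbs b / (1 - lam) ^ 2

/-- `B = {0} ∪ {b_1, …, b_m}`. -/
def digits : Set ℚ := insert 0 (Set.range b)

/-- `R` has all its coefficients in `B - B`. -/
def IsDiffPoly (R : Polynomial ℚ) : Prop :=
  ∀ k, ∃ u ∈ digits b, ∃ v ∈ digits b, R.coeff k = u - v

/-- The set `𝒜` of translation parts. -/
def setA : Set ℝ :=
  {x | |x| < dStar lam b ∧ ∃ R : Polynomial ℚ, IsDiffPoly b R ∧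
    lam ^ (-(maxExp p : ℤ) + 2) * x = Polynomial.aeval lam⁻¹ R}

/-- The vertex set `Θ = {n ∈ ℤ : 0 ≤ n ≤ T - 1} × 𝒜`. -/
def Theta : Set (ℤ × ℝ) :=
  {n : ℤ | 0 ≤ n ∧ n ≤ (maxExp p : ℤ) - 1} ×ˢ setA lam p b

/-- Two integers have different signs in the weak sense that their product is nonpositive. -/
def DiffSigns (x y : ℤ) : Prop := x * y ≤ 0

/-- The directed graph `G*` on `Θ`: there is an edge from `(q, c)` to `(q', c')` iff
`(q', c') = (p_β, b_β)⁻¹ (q, c) (p_α, b_α)` for words `α, β` with `1 ≤ p_α, p_β ≤ 2T - 1` such that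
`q, q - p_β, q'` have alternating signs. -/
def GStar : Digraph (Theta lam p b) where
  Adj v w := ∃ α β : List (Fin m),
    (1 ≤ (wordElt lam p b α).1 ∧ (wordElt lam p b α).1 ≤ 2 * (maxExp p : ℤ) - 1) ∧
    (1 ≤ (wordElt lam p b β).1 ∧ (wordElt lam p b β).1 ≤ 2 * (maxExp p : ℤ) - 1) ∧
    w.1 = gmul lam (gmul lam (ginv lam (wordElt lam p b β)) v.1) (wordElt lam p b α) ∧
    DiffSigns v.1.1 (v.1.1 - (wordElt lam p b β).1) ∧
    DiffSigns (v.1.1 - (wordElt lam p b β).1) w.1.1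

/-- The set `Ψ` of starting points. -/
def Psi : Set (ℤ × ℝ) :=
  {g | ∃ i j : Fin m, i ≠ j ∧ p i ≤ p j ∧
    lam ^ (-(p i : ℤ)) * |(b j : ℝ) - (b i : ℝ)| < dStar lam b ∧
    g = gmul lam (ginv lam (letter p b i)) (letter p b j)}

end IFS

end OSCGraph

end

/-!
The open set condition fails exactly when two distinct words `σ ≠ τ` over the alphabet define the
same similitude, that is, when `wordElt` is not injective; and such exact overlaps are exactly what
the paths of `G*` from `Ψ` to `(0, 0)` record.

*Open sets and overlaps.* If the open set condition holds with `U`, then words with distinct first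
letters map `U` into disjoint sets, so `wordElt` is injective (`injective_of_openSetCondition`).
The converse is `openSetCondition_of_injective`. Take an interval `I` mapped into itself by all
`S_i`, and call `τ` a neighbour of `σ` if `S_τ(I)` meets `S_σ(I)` and the exponent of `τ` reaches
that of `σ` exactly at the last letter of `τ`. The translation part of `S_σ⁻¹ S_τ` is then a
bounded value at `lam⁻¹` of a polynomial with coefficients in a fixed finite set of rationals. As
`lam⁻¹` is a Pisot–Vijayaraghavan number, all conjugates of such values are bounded too, so there
are only finitely many of them (`finite_diffPoly_values`). Without exact overlaps the number of
neighbours is therefore bounded, and some `σ` has the maximal number. Prefixing `ω` to `σ` cannot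
create new neighbours, so every neighbour of `ω σ` begins with `ω`; this makes the open set
`⋃ ω, S_{ω σ}(I)` satisfy the open set condition.

*Overlaps and paths.* Multiplying out the edges of a path from `Ψ` to `(0, 0)` gives two words with
distinct first letters and equal products (`not_injective_of_path`). Conversely
(`exists_path_to_zero`), if `σ s` and `τ t` have the same product, then `σ⁻¹ τ = s t⁻¹`, which
bounds its translation part. Reading the two overlapping words letter by letter, alternately
letting one overtake the other in exponent, keeps the difference of exponents in the range
prescribed by `Θ` and produces a path to `(0, 0)`.
-/

namespace OSCGraph

open Polynomial

/-! ### The group law and words -/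

section Words

variable {m : ℕ} {lam : ℝ} {p : Fin m → ℕ} {b : Fin m → ℚ}

theorem gmul_assoc (h : lam ≠ 0) (x y z : ℤ × ℝ) :
    gmul lam (gmul lam x y) z = gmul lam x (gmul lam y z) := by
  ext <;> simp only [gmul, zpow_add₀ h] <;> ring

theorem zero_gmul (x : ℤ × ℝ) : gmul lam (0, 0) x = x := by
  ext <;> simp [gmul]

theorem gmul_zero (x : ℤ × ℝ) : gmul lam x (0, 0) = x := by
  ext <;> simp [gmul]

theorem ginv_gmul_cancel (h : lam ≠ 0) (x y : ℤ × ℝ) :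
    gmul lam (ginv lam x) (gmul lam x y) = y := by
  rw [← gmul_assoc h, (gmul_ginv h x).2, zero_gmul]

theorem gmul_ginv_cancel (h : lam ≠ 0) (x y : ℤ × ℝ) :
    gmul lam x (gmul lam (ginv lam x) y) = y := by
  rw [← gmul_assoc h, (gmul_ginv h x).1, zero_gmul]

theorem gmul_left_cancel (h : lam ≠ 0) {x y z : ℤ × ℝ} (e : gmul lam x y = gmul lam x z) :
    y = z := by
  rw [← ginv_gmul_cancel h x y, e, ginv_gmul_cancel h]

theorem ginv_gmul_rev (h : lam ≠ 0) (x y : ℤ × ℝ) :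
    ginv lam (gmul lam x y) = gmul lam (ginv lam y) (ginv lam x) := by
  apply gmul_left_cancel h (x := gmul lam x y)
  rw [(gmul_ginv h _).1, gmul_assoc h, gmul_ginv_cancel h, (gmul_ginv h x).1]

theorem wordElt_cons (i : Fin m) (σ : List (Fin m)) :
    wordElt lam p b (i :: σ) = gmul lam (letter p b i) (wordElt lam p b σ) := rfl

theorem wordElt_singleton (i : Fin m) : wordElt lam p b [i] = letter p b i :=
  gmul_zero _

theorem wordElt_append (h : lam ≠ 0) (σ τ : List (Fin m)) :
    wordElt lam p b (σ ++ τ) = gmul lam (wordElt lam p b σ) (wordElt lam p b τ) := by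
  induction σ with
  | nil => exact (zero_gmul _).symm
  | cons i σ ih => rw [List.cons_append, wordElt_cons, ih, wordElt_cons, gmul_assoc h]

/-- The exponent `p_σ` of a word, as a natural number. -/
def height (p : Fin m → ℕ) (σ : List (Fin m)) : ℕ := (σ.map p).sum

@[simp] theorem height_nil : height p [] = 0 := rfl

@[simp] theorem height_cons (i : Fin m) (σ : List (Fin m)) :
    height p (i :: σ) = p i + height p σ := by simp [height]

@[simp] theorem height_append (σ τ : List (Fin m)) :
    height p (σ ++ τ) = height p σ + height p τ := by simp [height]

theorem height_pos (hp : ∀ i, 1 ≤ p i) {σ : List (Fin m)} (h : σ ≠ []) : 0 < height p σ := by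
  cases σ with
  | nil => exact absurd rfl h
  | cons i σ => have := hp i; simp; omega

theorem wordElt_fst (σ : List (Fin m)) : (wordElt lam p b σ).1 = height p σ := by
  induction σ with
  | nil => rfl
  | cons i σ ih => simp [wordElt_cons, gmul, letter, ih]

theorem height_eq_of_wordElt_eq {σ τ : List (Fin m)}
    (h : wordElt lam p b σ = wordElt lam p b τ) : height p σ = height p τ := by
  have := congrArg Prod.fst h
  simpa only [wordElt_fst, Nat.cast_inj] using this

theorem le_maxExp (i : Fin m) : p i ≤ maxExp p := Finset.le_sup (Finset.mem_univ i)

theorem abs_le_maxAbs (i : Fin m) : |(b i : ℝ)| ≤ maxAbs b :=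
  le_ciSup (f := fun i => |(b i : ℝ)|) (Set.finite_range _).bddAbove i

theorem maxAbs_pos (hb : ∃ i, b i ≠ 0) : 0 < maxAbs b := by
  obtain ⟨i, hi⟩ := hb
  exact (abs_pos.2 (by exact_mod_cast hi)).trans_le (abs_le_maxAbs i)

theorem wordElt_snd_cons (i : Fin m) (σ : List (Fin m)) :
    (wordElt lam p b (i :: σ)).2 = lam ^ p i * (wordElt lam p b σ).2 + b i := by
  simp [wordElt_cons, gmul, letter]

theorem abs_wordElt_snd_lt (h0 : 0 < lam) (h1 : lam < 1) (hp : ∀ i, 1 ≤ p i)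
    (hb : ∃ i, b i ≠ 0) (σ : List (Fin m)) :
    |(wordElt lam p b σ).2| < maxAbs b / (1 - lam) := by
  have hM := maxAbs_pos hb
  have h1' : 0 < 1 - lam := sub_pos.2 h1
  induction σ with
  | nil => simpa [wordElt] using div_pos hM h1'
  | cons i σ ih =>
    rw [wordElt_snd_cons]
    have hpow : lam ^ p i ≤ lam := pow_le_of_le_one h0.le h1.le (by have := hp i; omega)
    calc |lam ^ p i * (wordElt lam p b σ).2 + b i|
        ≤ lam ^ p i * |(wordElt lam p b σ).2| + |(b i : ℝ)| := by
          refine (abs_add_le _ _).trans_eq ?_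
          rw [abs_mul, abs_of_pos (pow_pos h0 _)]
      _ ≤ lam * |(wordElt lam p b σ).2| + maxAbs b := by
          gcongr
          exact abs_le_maxAbs i
      _ < lam * (maxAbs b / (1 - lam)) + maxAbs b := by gcongr
      _ = maxAbs b / (1 - lam) := by field_simp; ring

/-- Failure of injectivity on words can always be seen at words with distinct first letters. -/
theorem exists_ne_of_not_injective (h : lam ≠ 0) (hp : ∀ i, 1 ≤ p i)
    (hinj : ¬ Function.Injective (wordElt lam p b)) :
    ∃ i j σ τ, i ≠ j ∧ wordElt lam p b (i :: σ) = wordElt lam p b (j :: τ) := by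
  by_contra! hcon
  refine hinj fun σ => ?_
  induction σ with
  | nil =>
    intro τ e
    by_contra hne
    have := height_pos hp (Ne.symm hne)
    have := height_eq_of_wordElt_eq e
    simp at this
    omega
  | cons i σ ih =>
    intro τ e
    cases τ with
    | nil =>
      have := height_eq_of_wordElt_eq e
      have := height_pos hp (List.cons_ne_nil i σ)
      simp at *
      omega
    | cons j τ =>
      by_cases hij : i = j
      · subst hij
        rw [wordElt_cons, wordElt_cons] at e
        rw [ih (gmul_left_cancel h e)]
      · exact absurd e (hcon i j σ τ hij)

/-- The first moment at which the height of a prefix of `w` exceeds `n`. -/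
theorem exists_split_height {w : List (Fin m)} {n : ℕ} (h : n < height p w) :
    ∃ w₁ a w₂, w = (w₁ ++ [a]) ++ w₂ ∧ height p w₁ ≤ n ∧ n < height p (w₁ ++ [a]) := by
  induction w generalizing n with
  | nil => simp at h
  | cons i w ih =>
    by_cases hi : n < p i
    · exact ⟨[], i, w, rfl, Nat.zero_le _, by simpa using hi⟩
    · have : n - p i < height p w := by
        simp at h
        omega
      obtain ⟨w₁, a, w₂, rfl, h1, h2⟩ := ih this
      refine ⟨i :: w₁, a, w₂, by simp, ?_, ?_⟩
      · simp; omega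
      · simp at h2 ⊢; omega

/-! ### Translation parts as polynomials in `lam⁻¹` -/

/-- The letter following a prefix `π` of `σ ++ [a]` contributes to the coefficient of degree
`N - p_π`. The bound on `σ` keeps these degrees nonnegative; as `p ≥ 1`, they strictly decrease
along the word, so that every coefficient comes from at most one letter. -/
theorem exists_digit_polynomial (h : lam ≠ 0) (hp : ∀ i, 1 ≤ p i) (σ : List (Fin m)) (a : Fin m)
    {N : ℕ} (hN : height p σ ≤ N) :
    ∃ P : ℚ[X], (∀ k, P.coeff k ∈ digits b) ∧ (∀ k, N < k → P.coeff k = 0) ∧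
      aeval lam⁻¹ P = lam⁻¹ ^ N * (wordElt lam p b (σ ++ [a])).2 := by
  induction σ generalizing N with
  | nil =>
    refine ⟨monomial N (b a), fun k => ?_, fun k hk => ?_, ?_⟩
    · rw [coeff_monomial]
      split_ifs
      exacts [Or.inr ⟨a, rfl⟩, Or.inl rfl]
    · rw [coeff_monomial, if_neg hk.ne]
    · simp [wordElt_singleton, letter, aeval_monomial, mul_comm]
  | cons i σ ih =>
    have hi := hp i
    simp only [height_cons] at hN
    obtain ⟨P, hP, hdeg, hval⟩ := ih (N := N - p i) (by omega)
    refine ⟨monomial N (b i) + P, fun k => ?_, fun k hk => ?_, ?_⟩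
    · rw [coeff_add, coeff_monomial]
      split_ifs with hk
      · rw [hdeg k (by omega), add_zero]
        exact Or.inr ⟨i, rfl⟩
      · rw [zero_add]
        exact hP k
    · rw [coeff_add, coeff_monomial, if_neg hk.ne, hdeg k (by omega), add_zero]
    · rw [map_add, hval, List.cons_append, wordElt_snd_cons, aeval_monomial]
      have : lam⁻¹ ^ N = lam⁻¹ ^ (N - p i) * lam⁻¹ ^ p i := by
        rw [← pow_add]; congr 1; omega
      have hl : lam⁻¹ ^ p i * lam ^ p i = 1 := by
        rw [← mul_pow, inv_mul_cancel₀ h, one_pow]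
      rw [this, eq_ratCast]
      linear_combination (-(lam⁻¹ ^ (N - p i)) * (wordElt lam p b (σ ++ [a])).2) * hl

theorem exists_isDiffPoly (h : lam ≠ 0) (hp : ∀ i, 1 ≤ p i) {σ τ : List (Fin m)} {a : Fin m}
    {N : ℕ} (hσ : σ ≠ []) (hσN : height p σ ≤ N + 1) (hτ : height p τ ≤ N) :
    ∃ R : ℚ[X], IsDiffPoly b R ∧
      aeval lam⁻¹ R =
        lam⁻¹ ^ N * ((wordElt lam p b (τ ++ [a])).2 - (wordElt lam p b σ).2) := by
  obtain ⟨σ₀, c, rfl⟩ := List.eq_nil_or_concat' σ |>.resolve_left hσ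
  have hc := hp c
  simp at hσN
  obtain ⟨P, hP, -, hPv⟩ := exists_digit_polynomial (b := b) h hp τ a hτ
  obtain ⟨Q, hQ, -, hQv⟩ := exists_digit_polynomial (b := b) h hp σ₀ c (N := N) (by omega)
  exact ⟨P - Q, fun k => ⟨_, hP k, _, hQ k, coeff_sub _ _ _⟩, by rw [map_sub, hPv, hQv, mul_sub]⟩

theorem ginv_gmul_wordElt_fst (σ τ : List (Fin m)) :
    (gmul lam (ginv lam (wordElt lam p b σ)) (wordElt lam p b τ)).1 =
      (height p τ : ℤ) - height p σ := by
  simp [gmul, ginv, wordElt_fst]; ring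

theorem ginv_gmul_wordElt_snd (σ τ : List (Fin m)) :
    (gmul lam (ginv lam (wordElt lam p b σ)) (wordElt lam p b τ)).2 =
      lam⁻¹ ^ height p σ * ((wordElt lam p b τ).2 - (wordElt lam p b σ).2) := by
  simp [gmul, ginv, wordElt_fst]; ring

end Words

/-! ### Finiteness for Pisot–Vijayaraghavan numbers -/

theorem exists_common_denominator {s : Set ℚ} (hs : s.Finite) :
    ∃ D : ℤ, D ≠ 0 ∧ ∀ x ∈ s, ∃ n : ℤ, (D : ℚ) * x = n := by
  induction s, hs using Set.Finite.induction_on with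
  | empty => exact ⟨1, one_ne_zero, by simp⟩
  | @insert a s _ _ ih =>
    obtain ⟨D, hD, h⟩ := ih
    refine ⟨D * a.den, mul_ne_zero hD (by exact_mod_cast a.den_ne_zero), ?_⟩
    rintro x (rfl | hx)
    · refine ⟨D * x.num, ?_⟩
      have := Rat.den_mul_eq_num x
      push_cast
      rw [mul_assoc, this]
    · obtain ⟨n, hn⟩ := h x hx
      refine ⟨n * a.den, ?_⟩
      push_cast
      rw [← hn]; ring

theorem norm_aeval_le_of_norm_lt_one {z : ℂ} (hz : ‖z‖ < 1) {E : ℝ} {R : ℚ[X]}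
    (hR : ∀ k, |(R.coeff k : ℝ)| ≤ E) : ‖aeval z R‖ ≤ E * (1 - ‖z‖)⁻¹ := by
  have hE : 0 ≤ E := (abs_nonneg _).trans (hR 0)
  rw [aeval_eq_sum_range]
  calc ‖∑ k ∈ Finset.range (R.natDegree + 1), R.coeff k • z ^ k‖
      ≤ ∑ k ∈ Finset.range (R.natDegree + 1), E * ‖z‖ ^ k := by
        refine norm_sum_le_of_le _ fun k _ => ?_
        rw [Rat.smul_def, norm_mul, norm_pow]
        gcongr
        simpa using hR k
    _ = E * ∑ k ∈ Finset.range (R.natDegree + 1), ‖z‖ ^ k := by rw [Finset.mul_sum]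
    _ ≤ E * (1 - ‖z‖)⁻¹ := by
        gcongr
        rw [← tsum_geometric_of_lt_one (norm_nonneg z) hz]
        exact (summable_geometric_of_lt_one (norm_nonneg z) hz).sum_le_tsum _
          fun k _ => by positivity

/-- Garsia's lemma: up to a common denominator the values in question are algebraic integers of
`ℚ(θ)`, and all their conjugates are bounded, by a geometric series at each conjugate of `θ` other
than `θ` itself. -/
theorem finite_diffPoly_values {m : ℕ} (b : Fin m → ℚ) {θ : ℝ} (hθ : IsPV θ) (C : ℝ) :
    {x : ℝ | |x| ≤ C ∧ ∃ R : ℚ[X], IsDiffPoly b R ∧ aeval θ R = x}.Finite := by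
  obtain ⟨-, hint, hconj⟩ := hθ
  have hfin : (digits b).Finite := (Set.finite_range b).insert 0
  obtain ⟨D, hD, hDint⟩ := exists_common_denominator hfin
  obtain ⟨E₀, hE₀⟩ : ∃ E : ℝ, ∀ u ∈ digits b, |(u : ℝ)| ≤ E := by
    obtain ⟨E, hE⟩ := (hfin.image fun u : ℚ => |(u : ℝ)|).bddAbove
    exact ⟨E, fun u hu => hE ⟨u, hu, rfl⟩⟩
  have hcoeff : ∀ R : ℚ[X], IsDiffPoly b R → ∀ k, |(R.coeff k : ℝ)| ≤ 2 * E₀ := by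
    intro R hR k
    obtain ⟨u, hu, v, hv, e⟩ := hR k
    rw [e, Rat.cast_sub]
    have := abs_sub (u : ℝ) v
    linarith [hE₀ u hu, hE₀ v hv]
  have hintQ : IsIntegral ℚ θ := hint.tower_top
  let K := IntermediateField.adjoin ℚ {θ}
  let g : K := IntermediateField.AdjoinSimple.gen ℚ θ
  have hgθ : (g : ℝ) = θ := IntermediateField.AdjoinSimple.coe_gen ℚ θ
  have : FiniteDimensional ℚ K := IntermediateField.adjoin.finiteDimensional hintQ
  have : NumberField K := { }
  have hgint : IsIntegral ℤ g := by
    rw [← isIntegral_algebraMap_iff (B := ℝ) (algebraMap K ℝ).injective]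
    exact hint
  obtain ⟨A, hA⟩ : ∃ A : ℝ, ∀ φ : K →+* ℂ, 2 * E₀ * (1 - ‖φ g‖)⁻¹ ≤ A := by
    obtain ⟨A, hA⟩ := (Set.finite_range fun φ : K →+* ℂ => 2 * E₀ * (1 - ‖φ g‖)⁻¹).bddAbove
    exact ⟨A, fun φ => hA ⟨φ, rfl⟩⟩
  have hF := NumberField.Embeddings.finite_of_norm_le K ℂ (|(D : ℝ)| * max C A)
  refine (hF.image fun y : K => (y : ℝ) / D).subset ?_
  rintro x ⟨hxC, R, hR, rfl⟩
  have hval : ((aeval g R : K) : ℝ) = aeval θ R := by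
    have := aeval_algebraMap_apply ℝ g R
    rw [← hgθ]
    exact this.symm
  refine ⟨(D : K) * aeval g R, ⟨?_, fun φ => ?_⟩, ?_⟩
  · rw [aeval_eq_sum_range, Finset.mul_sum]
    refine IsIntegral.sum _ fun k _ => ?_
    obtain ⟨u, hu, v, hv, e⟩ := hR k
    obtain ⟨n, hn⟩ := hDint u hu
    obtain ⟨n', hn'⟩ := hDint v hv
    have : (D : K) * R.coeff k • g ^ k = ((n - n' : ℤ) : K) * g ^ k := by
      have h2 : (D : ℚ) * R.coeff k = ((n - n' : ℤ) : ℚ) := by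
        rw [e]; push_cast; rw [← hn, ← hn']; ring
      have h3 : (D : K) * (R.coeff k : K) = ((n - n' : ℤ) : K) := by
        exact_mod_cast congrArg (fun q : ℚ => (q : K)) h2
      rw [Rat.smul_def, ← mul_assoc, h3]
    rw [this]
    exact (isIntegral_algebraMap (R := ℤ) (x := n - n')).mul (hgint.pow k)
  · have hφ : φ (aeval g R) = aeval (φ g) R := by
      exact (aeval_algHom_apply φ.toRatAlgHom g R).symm
    rw [map_mul, norm_mul, map_intCast, Complex.norm_intCast, hφ]
    gcongr
    by_cases hz : φ g = (θ : ℂ)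
    · refine le_max_of_le_left ?_
      have := aeval_algebraMap_apply ℂ θ R
      rw [hz]
      rw [show (θ : ℂ) = algebraMap ℝ ℂ θ from rfl, this]
      simpa using hxC
    · refine le_max_of_le_right ?_
      have hroot : aeval (φ g) (minpoly ℚ θ) = 0 := by
        have h1 : aeval g (minpoly ℚ θ) = 0 := IntermediateField.aeval_gen_minpoly ℚ θ
        have := aeval_algHom_apply φ.toRatAlgHom g (minpoly ℚ θ)
        rw [h1, map_zero] at this
        exact this
      exact (norm_aeval_le_of_norm_lt_one (hconj _ hroot hz) (hcoeff R hR)).trans (hA φ)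
  · have hD' : (D : ℝ) ≠ 0 := by exact_mod_cast hD
    simp only
    rw [MulMemClass.coe_mul, hval]
    simp [hD']

/-! ### The open set condition and exact overlaps -/

section OpenSet

variable {m : ℕ} {lam : ℝ} {p : Fin m → ℕ} {b : Fin m → ℚ}

theorem simil_letter (i : Fin m) : simil lam (letter p b i) = ifs lam p b i := by
  funext t; simp [simil, letter, ifs]

theorem simil_wordElt_cons (h : lam ≠ 0) (i : Fin m) (σ : List (Fin m)) (x : ℝ) :
    simil lam (wordElt lam p b (i :: σ)) x = ifs lam p b i (simil lam (wordElt lam p b σ) x) := by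
  rw [wordElt_cons, simil_gmul h, simil_letter]; rfl

theorem simil_wordElt_append (h : lam ≠ 0) (σ τ : List (Fin m)) (x : ℝ) :
    simil lam (wordElt lam p b (σ ++ τ)) x =
      simil lam (wordElt lam p b σ) (simil lam (wordElt lam p b τ) x) := by
  rw [wordElt_append h, simil_gmul h]; rfl

theorem simil_wordElt_mem (h : lam ≠ 0) {U : Set ℝ} (hU : ∀ i, ∀ x ∈ U, ifs lam p b i x ∈ U)
    (σ : List (Fin m)) {x : ℝ} (hx : x ∈ U) : simil lam (wordElt lam p b σ) x ∈ U := by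
  induction σ with
  | nil => simpa [wordElt, simil] using hx
  | cons i σ ih => rw [simil_wordElt_cons h]; exact hU i _ ih

theorem injective_of_openSetCondition (h : lam ≠ 0) (hp : ∀ i, 1 ≤ p i)
    (hO : OpenSetCondition (ifs lam p b)) : Function.Injective (wordElt lam p b) := by
  obtain ⟨U, -, ⟨x, hx⟩, hsub, hdisj⟩ := hO
  have hU : ∀ i, ∀ x ∈ U, ifs lam p b i x ∈ U := fun i x hx =>
    hsub (Set.mem_iUnion.2 ⟨i, x, hx, rfl⟩)
  by_contra hinj
  obtain ⟨i, j, σ, τ, hij, e⟩ := exists_ne_of_not_injective h hp hinj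
  have : simil lam (wordElt lam p b (i :: σ)) x ∈ ifs lam p b i '' U ∩ ifs lam p b j '' U := by
    refine ⟨?_, ?_⟩
    · rw [simil_wordElt_cons h]
      exact ⟨_, simil_wordElt_mem h hU σ hx, rfl⟩
    · rw [e, simil_wordElt_cons h]
      exact ⟨_, simil_wordElt_mem h hU τ hx, rfl⟩
  rw [hdisj i j hij] at this
  exact this

/-- The neighbours of a word `σ` relative to a set `I`: the words `τ` whose height reaches that of
`σ` exactly at their last letter and for which `S_σ(I)` and `S_τ(I)` meet. -/
def neighbours (lam : ℝ) (p : Fin m → ℕ) (b : Fin m → ℚ) (I : Set ℝ) (σ : List (Fin m)) :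
    Set (List (Fin m)) :=
  {τ | (∃ τ₀ a, τ = τ₀ ++ [a] ∧ height p τ₀ < height p σ ∧ height p σ ≤ height p τ) ∧
    (simil lam (wordElt lam p b σ) '' I ∩ simil lam (wordElt lam p b τ) '' I).Nonempty}

theorem append_mem_neighbours (h : lam ≠ 0) {I : Set ℝ} {σ τ : List (Fin m)}
    (hτ : τ ∈ neighbours lam p b I σ) (ω : List (Fin m)) :
    ω ++ τ ∈ neighbours lam p b I (ω ++ σ) := by
  obtain ⟨⟨τ₀, a, rfl, h1, h2⟩, _, ⟨x, hx, rfl⟩, y, hy, e⟩ := hτ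
  refine ⟨⟨ω ++ τ₀, a, by simp, by simpa using h1, by simpa using h2⟩, _, ⟨x, hx, rfl⟩, y, hy, ?_⟩
  rw [simil_wordElt_append h, e, simil_wordElt_append h]

/-- The relative positions `S_σ⁻¹ S_τ` of neighbours lie in one finite set, so if distinct words
define distinct maps, the number of neighbours is bounded. -/
theorem exists_card_neighbours_le (hlam : IsPV lam⁻¹) (h0 : 0 < lam) (h1 : lam < 1)
    (hp : ∀ i, 1 ≤ p i) (hinj : Function.Injective (wordElt lam p b)) (r : ℝ) :
    ∃ L : ℕ, ∀ σ : List (Fin m), σ ≠ [] →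
      (neighbours lam p b (Set.Ioo (-r) r) σ).Finite ∧
      (neighbours lam p b (Set.Ioo (-r) r) σ).ncard ≤ L := by
  have h := h0.ne'
  let F : Set (ℤ × ℝ) := Set.Icc (0 : ℤ) (maxExp p) ×ˢ
    {x : ℝ | |x| ≤ 2 * r ∧ ∃ R : ℚ[X], IsDiffPoly b R ∧ aeval lam⁻¹ R = x}
  have hF : F.Finite := (Set.finite_Icc _ _).prod (finite_diffPoly_values b hlam _)
  refine ⟨F.ncard, fun σ hσ => ?_⟩
  set f : List (Fin m) → ℤ × ℝ := fun τ =>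
    gmul lam (ginv lam (wordElt lam p b σ)) (wordElt lam p b τ) with hf
  have hfinj : Function.Injective f := fun τ τ' e => hinj (gmul_left_cancel h e)
  have hmaps : Set.MapsTo f (neighbours lam p b (Set.Ioo (-r) r) σ) F := by
    rintro _ ⟨⟨τ, a, rfl, hτ1, hτ2⟩, _, ⟨x, hx, rfl⟩, y, hy, e⟩
    refine Set.mem_prod.2 ⟨?_, ?_, ?_⟩
    · rw [hf, ginv_gmul_wordElt_fst]
      have := le_maxExp (p := p) a
      simp at hτ2 ⊢
      omega
    · have hq : (wordElt lam p b (τ ++ [a])).2 - (wordElt lam p b σ).2 =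
          lam ^ height p σ * x - lam ^ height p (τ ++ [a]) * y := by
        simp only [simil, wordElt_fst, zpow_natCast] at e
        linarith
      have hpow : lam ^ height p (τ ++ [a]) =
          lam ^ height p σ * lam ^ (height p (τ ++ [a]) - height p σ) := by
        rw [← pow_add]; congr 1; omega
      rw [hf, ginv_gmul_wordElt_snd, hq, hpow, mul_assoc, ← mul_sub, ← mul_assoc, ← mul_pow,
        inv_mul_cancel₀ h, one_pow, one_mul]
      have hx' := abs_lt.2 hx
      have hy' := abs_lt.2 hy
      have hle : lam ^ (height p (τ ++ [a]) - height p σ) ≤ 1 := pow_le_one₀ h0.le h1.le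
      calc |x - lam ^ (height p (τ ++ [a]) - height p σ) * y|
          ≤ |x| + lam ^ (height p (τ ++ [a]) - height p σ) * |y| := by
            refine (abs_sub _ _).trans_eq ?_
            rw [abs_mul, abs_of_pos (pow_pos h0 _)]
        _ ≤ |x| + 1 * |y| := by gcongr
        _ ≤ 2 * r := by linarith
    · rw [hf, ginv_gmul_wordElt_snd]
      exact exists_isDiffPoly h hp hσ (Nat.le_succ _) hτ1.le
  exact ⟨Set.Finite.of_finite_image (hF.subset hmaps.image_subset) hfinj.injOn,
    Set.ncard_le_ncard_of_injOn f hmaps hfinj.injOn hF⟩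

/-- A word `σ` with the largest possible number of neighbours has the property that the neighbours
of `ω σ` are exactly the words `ω τ` with `τ` a neighbour of `σ`; hence all of them begin like `ω`,
and the union of the sets `S_{ω σ}(I)` witnesses the open set condition. -/
theorem openSetCondition_of_injective (hlam : IsPV lam⁻¹) (h0 : 0 < lam) (h1 : lam < 1)
    (hp : ∀ i, 1 ≤ p i) (hb : ∃ i, b i ≠ 0) (hinj : Function.Injective (wordElt lam p b)) :
    OpenSetCondition (ifs lam p b) := by
  have h := h0.ne'
  have h1' : 0 < 1 - lam := sub_pos.2 h1
  set r : ℝ := maxAbs b / (1 - lam) with hr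
  have hr0 : 0 < r := div_pos (maxAbs_pos hb) h1'
  have hMr : maxAbs b = r * (1 - lam) := by rw [hr]; field_simp
  set I : Set ℝ := Set.Ioo (-r) r with hI
  have hIinv : ∀ i, ∀ x ∈ I, ifs lam p b i x ∈ I := by
    intro i x hx
    rw [hI, Set.mem_Ioo, ← abs_lt] at hx ⊢
    have hpow : lam ^ p i ≤ lam := pow_le_of_le_one h0.le h1.le (by have := hp i; omega)
    calc |lam ^ p i * x + b i| ≤ lam ^ p i * |x| + |(b i : ℝ)| := by
          refine (abs_add_le _ _).trans_eq ?_
          rw [abs_mul, abs_of_pos (pow_pos h0 _)]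
      _ ≤ lam * |x| + maxAbs b := by
          gcongr
          exact abs_le_maxAbs i
      _ < lam * r + maxAbs b := by gcongr
      _ = r := by rw [hMr]; ring
  obtain ⟨L, hL⟩ := exists_card_neighbours_le hlam h0 h1 hp hinj r
  obtain ⟨i₀, -⟩ := hb
  obtain ⟨σ, hσ, hmax⟩ : ∃ σ : List (Fin m), σ ≠ [] ∧ ∀ τ : List (Fin m), τ ≠ [] →
      (neighbours lam p b I τ).ncard ≤ (neighbours lam p b I σ).ncard := by
    have hbdd : BddAbove ((fun τ => (neighbours lam p b I τ).ncard) '' {τ | τ ≠ []}) :=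
      ⟨L, by rintro _ ⟨τ, hτ, rfl⟩; exact (hL τ hτ).2⟩
    obtain ⟨_, ⟨σ, hσ, rfl⟩, hub⟩ := hbdd.exists_isGreatest_of_nonempty
      ⟨_, [i₀], List.cons_ne_nil _ _, rfl⟩
    exact ⟨σ, hσ, fun τ hτ => hub ⟨τ, hτ, rfl⟩⟩
  have hnb : ∀ ω, neighbours lam p b I (ω ++ σ) = (ω ++ ·) '' neighbours lam p b I σ := by
    intro ω
    have hne : ω ++ σ ≠ [] := by simp [hσ]
    refine (Set.eq_of_subset_of_ncard_le ?_ ?_ (hL _ hne).1).symm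
    · rintro _ ⟨τ, hτ, rfl⟩
      exact append_mem_neighbours h hτ ω
    · rw [Set.ncard_image_of_injective _ (List.append_right_injective ω)]
      exact hmax _ hne
  -- The image of `I` under the longer of two words lies in the image under a prefix of it, and
  -- that prefix is a neighbour of the shorter word as soon as the two images meet.
  have key : ∀ i j ω ω', i ≠ j → height p (i :: ω) ≤ height p (j :: ω') → ∀ x ∈ I, ∀ y ∈ I,
      simil lam (wordElt lam p b ((i :: ω) ++ σ)) x ≠
        simil lam (wordElt lam p b ((j :: ω') ++ σ)) y := by
    intro i j ω ω' hij hle x hx y hy e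
    have hpos : 0 < height p ((i :: ω) ++ σ) := height_pos hp (by simp)
    have hlt : height p ((i :: ω) ++ σ) - 1 < height p ((j :: ω') ++ σ) := by
      rw [height_append] at hpos ⊢
      rw [height_append]
      omega
    obtain ⟨w, a, w', hw, hw1, hw2⟩ := exists_split_height hlt
    have hmem : w ++ [a] ∈ neighbours lam p b I ((i :: ω) ++ σ) := by
      refine ⟨⟨w, a, rfl, by omega, by omega⟩, _, ⟨x, hx, rfl⟩, _,
        simil_wordElt_mem h hIinv w' hy, ?_⟩
      rw [e, hw, ← simil_wordElt_append h]
    rw [hnb] at hmem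
    obtain ⟨τ, -, hτ⟩ := hmem
    simp only at hτ
    rw [← hτ] at hw
    simp at hw
    exact hij hw.1.symm
  refine ⟨⋃ ω, simil lam (wordElt lam p b (ω ++ σ)) '' I, ?_, ?_, ?_, ?_⟩
  · refine isOpen_iUnion fun ω => ?_
    have hc : lam ^ (wordElt lam p b (ω ++ σ)).1 ≠ 0 := zpow_ne_zero _ h
    exact ((Homeomorph.mulLeft₀ _ hc).trans
      (Homeomorph.addRight (wordElt lam p b (ω ++ σ)).2)).isOpenMap _ isOpen_Ioo
  · exact ⟨_, Set.mem_iUnion.2 ⟨[], 0, by simp [hI, hr0], rfl⟩⟩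
  · intro x hx
    obtain ⟨i, _, hy, rfl⟩ := Set.mem_iUnion.1 hx
    obtain ⟨ω, z, hz, rfl⟩ := Set.mem_iUnion.1 hy
    exact Set.mem_iUnion.2 ⟨i :: ω, z, hz, simil_wordElt_cons h i _ z⟩
  · intro i j hij
    rw [Set.eq_empty_iff_forall_notMem]
    rintro _ ⟨⟨_, hy, rfl⟩, _, hy', e⟩
    obtain ⟨ω, x, hx, rfl⟩ := Set.mem_iUnion.1 hy
    obtain ⟨ω', x', hx', rfl⟩ := Set.mem_iUnion.1 hy'
    rw [← simil_wordElt_cons h, ← simil_wordElt_cons h] at e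
    rcases le_total (height p (i :: ω)) (height p (j :: ω')) with hle | hle
    · exact key i j ω ω' hij hle x hx x' hx' e.symm
    · exact key j i ω' ω hij.symm hle x' hx' x hx e

end OpenSet

/-! ### Exact overlaps and paths in `G*` -/

section Paths

variable {m : ℕ} {lam : ℝ} {p : Fin m → ℕ} {b : Fin m → ℚ}

/-- Multiplying out the edges of a path yields two words that begin with distinct letters and
define the same map. -/
theorem not_injective_of_path (h : lam ≠ 0) {u v : Theta lam p b}
    (hu : (u : ℤ × ℝ) ∈ Psi lam p b) (hv : (v : ℤ × ℝ) = (0, 0))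
    (huv : Relation.ReflTransGen (GStar lam p b).Adj u v) :
    ¬ Function.Injective (wordElt lam p b) := by
  obtain ⟨i, j, hij, -, -, hu⟩ := hu
  have : ∃ σ τ, (v : ℤ × ℝ) =
      gmul lam (ginv lam (wordElt lam p b (i :: σ))) (wordElt lam p b (j :: τ)) := by
    clear hv
    induction huv with
    | refl => exact ⟨[], [], by rw [wordElt_singleton, wordElt_singleton, hu]⟩
    | tail _ hadj ih =>
      obtain ⟨σ, τ, e⟩ := ih
      obtain ⟨α, β, -, -, hw, -, -⟩ := hadj
      refine ⟨σ ++ β, τ ++ α, ?_⟩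
      rw [hw, e, ← List.cons_append, ← List.cons_append, wordElt_append h, wordElt_append h,
        ginv_gmul_rev h]
      simp only [gmul_assoc h]
  obtain ⟨σ, τ, e⟩ := this
  intro hinj
  have e2 : wordElt lam p b (j :: τ) = wordElt lam p b (i :: σ) := by
    rw [← gmul_ginv_cancel h (wordElt lam p b (i :: σ)) (wordElt lam p b (j :: τ)), ← e, hv,
      gmul_zero]
  have := hinj e2
  simp at this
  exact hij this.1.symm

theorem abs_ginv_gmul_snd_lt (h0 : 0 < lam) (h1 : lam < 1) (hp : ∀ i, 1 ≤ p i)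
    (hb : ∃ i, b i ≠ 0) {σ τ s t : List (Fin m)} (hle : height p σ ≤ height p τ)
    (e : wordElt lam p b (σ ++ s) = wordElt lam p b (τ ++ t)) :
    |(gmul lam (ginv lam (wordElt lam p b σ)) (wordElt lam p b τ)).2| < dStar lam b := by
  have h := h0.ne'
  have h1' : 0 < 1 - lam := sub_pos.2 h1
  have hM := maxAbs_pos hb
  have hpow : lam ^ height p τ = lam ^ height p σ * lam ^ (height p τ - height p σ) := by
    rw [← pow_add]; congr 1; omega
  have hq : (wordElt lam p b τ).2 - (wordElt lam p b σ).2 = lam ^ height p σ *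
      ((wordElt lam p b s).2 - lam ^ (height p τ - height p σ) * (wordElt lam p b t).2) := by
    have := congrArg Prod.snd e
    simp only [wordElt_append h, gmul, wordElt_fst, zpow_natCast] at this
    rw [hpow] at this
    linarith
  have hs := abs_wordElt_snd_lt h0 h1 hp hb s
  have ht := abs_wordElt_snd_lt h0 h1 hp hb t
  rw [ginv_gmul_wordElt_snd, hq, ← mul_assoc, ← mul_pow, inv_mul_cancel₀ h, one_pow, one_mul]
  have hle1 : lam ^ (height p τ - height p σ) ≤ 1 := pow_le_one₀ h0.le h1.le
  calc |(wordElt lam p b s).2 - lam ^ (height p τ - height p σ) * (wordElt lam p b t).2|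
      ≤ |(wordElt lam p b s).2| +
          lam ^ (height p τ - height p σ) * |(wordElt lam p b t).2| := by
        refine (abs_sub _ _).trans_eq ?_
        rw [abs_mul, abs_of_pos (pow_pos h0 _)]
    _ ≤ |(wordElt lam p b s).2| + 1 * |(wordElt lam p b t).2| := by gcongr
    _ < maxAbs b / (1 - lam) + maxAbs b / (1 - lam) := by linarith
    _ = 2 * maxAbs b / (1 - lam) := by ring
    _ ≤ dStar lam b := by
        unfold dStar
        gcongr
        nlinarith

theorem ginv_gmul_mem_Theta (h0 : 0 < lam) (h1 : lam < 1) (hp : ∀ i, 1 ≤ p i)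
    (hb : ∃ i, b i ≠ 0) {σ τ s t : List (Fin m)} {a : Fin m} (hσ : σ ≠ [])
    (hlt : height p τ < height p σ) (hle : height p σ ≤ height p (τ ++ [a]))
    (e : wordElt lam p b (σ ++ s) = wordElt lam p b (τ ++ [a] ++ t)) :
    gmul lam (ginv lam (wordElt lam p b σ)) (wordElt lam p b (τ ++ [a])) ∈ Theta lam p b := by
  have h := h0.ne'
  have ha := le_maxExp (p := p) a
  have ha1 := hp a
  refine Set.mem_prod.2 ⟨?_, abs_ginv_gmul_snd_lt h0 h1 hp hb hle e, ?_⟩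
  · rw [ginv_gmul_wordElt_fst]
    simp at hle ⊢
    omega
  · have hpos := height_pos hp hσ
    obtain ⟨R, hR, hval⟩ := exists_isDiffPoly (b := b) (σ := σ) (τ := τ) (a := a)
      (N := maxExp p + height p σ - 2) h hp hσ (by omega) (by omega)
    refine ⟨R, hR, ?_⟩
    rw [hval, ginv_gmul_wordElt_snd, ← mul_assoc]
    congr 1
    rw [inv_pow, inv_pow, ← zpow_natCast, ← zpow_natCast, ← zpow_neg, ← zpow_neg, ← zpow_add₀ h]
    congr 1
    push_cast [show 2 ≤ maxExp p + height p σ by omega]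
    ring

theorem zero_mem_Theta (h1 : lam < 1) (hp : ∀ i, 1 ≤ p i) (hb : ∃ i, b i ≠ 0) :
    ((0, 0) : ℤ × ℝ) ∈ Theta lam p b := by
  have hM := maxAbs_pos hb
  have h1' : 0 < 1 - lam := sub_pos.2 h1
  obtain ⟨i, -⟩ := hb
  have := le_maxExp (p := p) i
  have := hp i
  refine Set.mem_prod.2 ⟨⟨le_rfl, by simp; omega⟩, ?_, 0, fun k => ?_, by simp⟩
  · rw [abs_zero]
    unfold dStar
    positivity
  · exact ⟨0, Or.inl rfl, 0, Or.inl rfl, by simp⟩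

/-- An exact overlap `σ s = τ t` in which `τ` has just caught up with `σ` in height gives a path
from `σ⁻¹ τ` to `(0, 0)`. Each edge lets `σ` strictly overtake `τ`, and then `τ` catch up. Once
`τ` is exhausted, the same letter is appended to both words, which lets `σ` overtake `τ` a last
time. -/
theorem exists_path_to_zero (h0 : 0 < lam) (h1 : lam < 1) (hp : ∀ i, 1 ≤ p i)
    (hb : ∃ i, b i ≠ 0) (σ τ s t : List (Fin m)) (a : Fin m) (hσ : σ ≠ [])
    (hlt : height p τ < height p σ) (hle : height p σ ≤ height p (τ ++ [a]))
    (e : wordElt lam p b (σ ++ s) = wordElt lam p b (τ ++ [a] ++ t)) :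
    Relation.ReflTransGen (GStar lam p b).Adj
      ⟨_, ginv_gmul_mem_Theta h0 h1 hp hb hσ hlt hle e⟩ ⟨(0, 0), zero_mem_Theta h1 hp hb⟩ := by
  have h := h0.ne'
  have ha := le_maxExp (p := p) a
  have ha1 := hp a
  induction hn : s.length using Nat.strong_induction_on generalizing σ τ s t a with
  | _ n ih =>
  subst hn
  have hH := height_eq_of_wordElt_eq e
  by_cases ht : t = []
  · subst ht
    rw [List.append_nil] at e hH
    refine Relation.ReflTransGen.single ⟨[a], s ++ [a], ?_, ?_, ?_, ?_, ?_⟩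
    · simp only [wordElt_fst, height_cons, height_nil]
      omega
    · simp only [wordElt_fst, height_append, height_cons, height_nil] at hH ⊢
      omega
    · show (0, 0) = _
      rw [← gmul_assoc h, ← ginv_gmul_rev h, ← wordElt_append h, gmul_assoc h, ← wordElt_append h,
        ← List.append_assoc, wordElt_append h (σ ++ s), e, ← wordElt_append h, (gmul_ginv h _).2]
    · show (gmul lam _ _).1 * ((gmul lam _ _).1 - _) ≤ 0
      rw [ginv_gmul_wordElt_fst, wordElt_fst]
      simp only [height_append, height_cons, height_nil] at hH hle ⊢
      exact mul_nonpos_of_nonneg_of_nonpos (by omega) (by omega)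
    · simp [DiffSigns]
  · have htpos := height_pos hp ht
    simp only [height_append, height_cons, height_nil] at hH hle
    obtain ⟨s₁, c, s₂, rfl, hs1, hs2⟩ := exists_split_height (p := p) (w := s)
      (n := height p (τ ++ [a]) - height p σ)
      (by simp only [height_append, height_cons, height_nil]; omega)
    simp only [height_append, height_cons, height_nil] at hH hs1 hs2
    obtain ⟨t₁, d, t₂, rfl, ht1, ht2⟩ := exists_split_height (p := p) (w := t)
      (n := height p (σ ++ (s₁ ++ [c])) - height p (τ ++ [a]) - 1)
      (by simp only [height_append, height_cons, height_nil]; omega)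
    simp only [height_append, height_cons, height_nil] at hH ht1 ht2
    have hc := le_maxExp (p := p) c
    have hd := le_maxExp (p := p) d
    have hc1 := hp c
    have hd1 := hp d
    have e' : wordElt lam p b ((σ ++ (s₁ ++ [c])) ++ s₂) =
        wordElt lam p b ((τ ++ [a] ++ t₁) ++ [d] ++ t₂) := by
      simpa only [List.append_assoc] using e
    have hlt' : height p (τ ++ [a] ++ t₁) < height p (σ ++ (s₁ ++ [c])) := by
      simp only [height_append, height_cons, height_nil]; omega
    have hle' : height p (σ ++ (s₁ ++ [c])) ≤ height p (τ ++ [a] ++ t₁ ++ [d]) := by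
      simp only [height_append, height_cons, height_nil]; omega
    refine Relation.ReflTransGen.head ?_ (ih s₂.length (by simp; omega) (σ ++ (s₁ ++ [c]))
      (τ ++ [a] ++ t₁) s₂ t₂ d (by simp) hlt' hle' e' hd hd1 rfl)
    refine ⟨t₁ ++ [d], s₁ ++ [c], ?_, ?_, ?_, ?_, ?_⟩
    · simp only [wordElt_fst, height_append, height_cons, height_nil]
      omega
    · simp only [wordElt_fst, height_append, height_cons, height_nil]
      omega
    · show gmul lam _ _ = gmul lam (gmul lam _ (gmul lam _ _)) _
      rw [← gmul_assoc h, ← ginv_gmul_rev h, ← wordElt_append h, gmul_assoc h, ← wordElt_append h]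
      simp only [List.append_assoc]
    · show (gmul lam _ _).1 * ((gmul lam _ _).1 - _) ≤ 0
      rw [ginv_gmul_wordElt_fst, wordElt_fst]
      simp only [height_append, height_cons, height_nil]
      exact mul_nonpos_of_nonneg_of_nonpos (by omega) (by omega)
    · show ((gmul lam _ _).1 - _) * (gmul lam _ _).1 ≤ 0
      rw [ginv_gmul_wordElt_fst, ginv_gmul_wordElt_fst, wordElt_fst]
      simp only [height_append, height_cons, height_nil]
      exact mul_nonpos_of_nonpos_of_nonneg (by omega) (by omega)

theorem exists_path_of_not_injective (h0 : 0 < lam) (h1 : lam < 1) (hp : ∀ i, 1 ≤ p i)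
    (hb : ∃ i, b i ≠ 0) (hinj : ¬ Function.Injective (wordElt lam p b)) :
    ∃ u v : Theta lam p b, (u : ℤ × ℝ) ∈ Psi lam p b ∧ (v : ℤ × ℝ) = (0, 0) ∧
      Relation.ReflTransGen (GStar lam p b).Adj u v := by
  have h := h0.ne'
  obtain ⟨i, j, s, t, hij, hle, e⟩ : ∃ i j s t, i ≠ j ∧ p i ≤ p j ∧
      wordElt lam p b (i :: s) = wordElt lam p b (j :: t) := by
    obtain ⟨i, j, s, t, hij, e⟩ := exists_ne_of_not_injective h hp hinj
    rcases le_total (p i) (p j) with hle | hle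
    · exact ⟨i, j, s, t, hij, hle, e⟩
    · exact ⟨j, i, t, s, hij.symm, hle, e.symm⟩
  have hi := hp i
  refine ⟨_, _, ⟨i, j, hij, hle, ?_, ?_⟩, rfl, exists_path_to_zero h0 h1 hp hb [i] [] s t j
    (by simp) (by simp; omega) (by simpa using hle) e⟩
  · have := abs_ginv_gmul_snd_lt h0 h1 hp hb (σ := [i]) (τ := [j]) (by simpa using hle) e
    rw [ginv_gmul_wordElt_snd, abs_mul, abs_of_pos (pow_pos (inv_pos.2 h0) _)] at this
    simpa [wordElt_singleton, letter] using this
  · simp [wordElt_singleton]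

end Paths

end OSCGraph

theorem mainTheorem4 {m : ℕ} (lam : ℝ) (hlam : OSCGraph.IsPV lam⁻¹)
    (p : Fin m → ℕ) (hp : ∀ i, 1 ≤ p i)
    (b : Fin m → ℚ) (hb : ∃ i, b i ≠ 0) :
    ¬ OSCGraph.OpenSetCondition (OSCGraph.ifs lam p b) ↔
      ∃ u v : OSCGraph.Theta lam p b,
        (u : ℤ × ℝ) ∈ OSCGraph.Psi lam p b ∧ (v : ℤ × ℝ) = (0, 0) ∧
        Relation.ReflTransGen (OSCGraph.GStar lam p b).Adj u v := by
  have h0 : 0 < lam := inv_pos.1 (zero_lt_one.trans hlam.1)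
  have h1 : lam < 1 := (one_lt_inv₀ h0).1 hlam.1
  constructor
  · intro hO
    exact OSCGraph.exists_path_of_not_injective h0 h1 hp hb fun hinj =>
      hO (OSCGraph.openSetCondition_of_injective hlam h0 h1 hp hb hinj)
  · rintro ⟨u, v, hu, hv, huv⟩ hO
    exact OSCGraph.not_injective_of_path h0.ne' hu hv huv
      (OSCGraph.injective_of_openSetCondition h0.ne' hp hO)
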